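/- Let $D\subset\mathbb R^d$ be open and bounded, $T>0$, $\alpha\in(1/2,1)$, and let $\mathcal A u=-\sum_{i,j}a^{ij}u_{x_ix_j}+\sum_i b^iu_{x_i}+cu$ with $a^{ij},b^i,c\in C^\infty(\mathbb R^d)$ be uniformly elliptic on $D$, and symmetric and positive definite on $H^2(D)\cap H^1_0(D)$ with respect to the inner product of $L^2(D)$. Let $\{(\lambda_n,\phi_n)\}_{n\ge1}$ be its Dirichlet eigensystem: $0<\lambda_1\le\lambda_2\le\cdots$, $\phi_n\in H^2(D)\cap H^1_0(D)$, $\mathcal A\phi_n=\lambda_n\phi_n$, and $(\phi_n)$ is an orthonormal basis of $L^2(D)$. Let $h\in L^\infty(0,T)$ with $h\ge c_h>0$ a.e., let $\mathbb W$ be a standard Wiener process on a probability space, and let $E_{\alpha,\beta}(z)=\sum_{k\ge0}z^k/\Gamma(k\alpha+\beta)$. For $f,g\in L^2(D)$ put $f_n=\langle f,\phi_n\rangle_{L^2(D)}$, $g_n=\langle g,\phi_n\rangle_{L^2(D)}$, and let $$u(\cdot,t)=\sum_{n\ge1}\Big(f_n\int_0^t(t-\tau)^{\alpha-1}E_{\alpha,\alpha}(-\lambda_n(t-\tau)^\alpha)h(\tau)\,d\tau+g_n\int_0^t(t-\tau)^{\alpha-1}E_{\alpha,\alpha}(-\lambda_n(t-\tau)^\alpha)\,d\mathbb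 W(\tau)\Big)\phi_n,\qquad 0\le t\le T,$$ be the mild solution of $\partial_t^\alpha u+\mathcal Au=f(x)h(t)+g(x)\dot{\mathbb W}(t)$ in $D\times(0,T]$ with zero initial and Dirichlet boundary data ($\partial_t^\alpha$ the Caputo derivative). Write $u_n(T)=\langle u(\cdot,T),\phi_n\rangle_{L^2(D)}$ and $$M_n=\int_0^T\tau^{\alpha-1}E_{\alpha,\alpha}(-\lambda_n\tau^\alpha)h(T-\tau)\,d\tau,\qquad K_{m,n}=\int_0^T\tau^{2\alpha-2}E_{\alpha,\alpha}(-\lambda_m\tau^\alpha)E_{\alpha,\alpha}(-\lambda_n\tau^\alpha)\,d\tau .$$ Suppose $f,g\in L^2(D)$, $g\neq0$, $g\in H^2(D)$, and let $N_0$ be an index with $g_{N_0}\ne0$. Then the random variables $u_n(T)$ are square integrable, $M_n>0$ and $K_{N_0,n}>0$ for all $n$, $\mathbb V(u_{N_0}(T))>0$, and $$f_n=\frac{\mathbb E\,u_n(T)}{M_n}\ \ (n\ge1),\qquad |g_{N_0}|=\sqrt{\mathbb V(u_{N_0}(T))/K_{N_0,N_0}},$$ and there is a sign $s\in\{1,-1\}$,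 independent of $n$, with $$s\,g_n=\frac{\mathrm{Cov}(u_{N_0}(T),u_n(T))}{\sqrt{\mathbb V(u_{N_0}(T))/K_{N_0,N_0}}\;K_{N_0,n}}\quad(n\ge1).$$ Consequently the data $\{\mathbb E\,u_n(T),\ \mathbb V(u_{N_0}(T)),\ \mathrm{Cov}(u_{N_0}(T),u_n(T)):n\ge1\}$ determine $f$ and $|g|$ uniquely: if $f'\in L^2(D)$ and $g'\in H^2(D)$ give a mild solution (with the same $h$ and $\mathbb W$) with the same data, then $f'=f$, $g'=g$ or $g'=-g$, and hence $|g'|=|g|$ in $L^2(D)$. -/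

import Mathlib

open MeasureTheory ProbabilityTheory Filter Set
open scoped NNReal ENNReal Topology Distributions

noncomputable section

namespace SFDE

/-! ### Sobolev spaces on an open set -/

variable {d : ℕ}

/-- The real Hilbert space `L²(D)` of an open set `D ⊆ ℝᵈ`. -/
abbrev L2 (D : TopologicalSpace.Opens (EuclideanSpace ℝ (Fin d))) : Type :=
  Lp ℝ 2 (volume.restrict (D : Set (EuclideanSpace ℝ (Fin d))))

/-- The classical partial derivative in the `i`-th coordinate. -/
def partialDeriv (i : Fin d) (ψ : EuclideanSpace ℝ (Fin d) → ℝ)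
    (x : EuclideanSpace ℝ (Fin d)) : ℝ :=
  fderiv ℝ ψ x (EuclideanSpace.single i 1)

variable {D : TopologicalSpace.Opens (EuclideanSpace ℝ (Fin d))}

/-- `v ∈ L²(D)` is the weak `i`-th partial derivative of `u ∈ L²(D)`. -/
def IsWeakPartial (i : Fin d) (u v : L2 D) : Prop :=
  ∀ ψ : 𝓓(D, ℝ),
    ∫ x in (D : Set (EuclideanSpace ℝ (Fin d))), u x * partialDeriv i ψ x
      = - ∫ x in (D : Set (EuclideanSpace ℝ (Fin d))), v x * ψ x

open Classical in
/-- The weak `i`-th partial derivative in `L²(D)` (it is unique when it exists; `0` otherwise). -/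
def weakPartial (i : Fin d) (u : L2 D) : L2 D :=
  if hu : ∃ v : L2 D, IsWeakPartial i u v then hu.choose else 0

/-- `u ∈ H¹(D)`. -/
def MemH1 (u : L2 D) : Prop :=
  ∀ i : Fin d, ∃ v : L2 D, IsWeakPartial i u v

/-- `u ∈ H²(D)`. -/
def MemH2 (u : L2 D) : Prop :=
  MemH1 u ∧ ∀ i : Fin d, MemH1 (weakPartial i u)

/-- `u ∈ H¹₀(D)`: `u` lies in the closure of the test functions for the `H¹(D)`-norm. -/
def MemH10 (u : L2 D) : Prop :=
  MemH1 u ∧ ∀ ε : ℝ≥0∞, 0 < ε → ∃ ψ : 𝓓(D, ℝ),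
    eLpNorm (fun x => ψ x - u x) 2
        (volume.restrict (D : Set (EuclideanSpace ℝ (Fin d)))) < ε ∧
      ∀ i : Fin d, eLpNorm (fun x => partialDeriv i ψ x - weakPartial i u x) 2
        (volume.restrict (D : Set (EuclideanSpace ℝ (Fin d)))) < ε

/-! ### The elliptic operator and its eigensystem -/

/-- The coefficients of `𝒜 u = -∑ aⁱʲ u_{xᵢxⱼ} + ∑ bⁱ u_{xᵢ} + c u`, smooth on `ℝᵈ`. -/
structure DiffOperator (d : ℕ) where
  a : Fin d → Fin d → EuclideanSpace ℝ (Fin d) → ℝ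
  b : Fin d → EuclideanSpace ℝ (Fin d) → ℝ
  c : EuclideanSpace ℝ (Fin d) → ℝ
  contDiff_a : ∀ i j, ContDiff ℝ (⊤ : ℕ∞) (a i j)
  contDiff_b : ∀ i, ContDiff ℝ (⊤ : ℕ∞) (b i)
  contDiff_c : ContDiff ℝ (⊤ : ℕ∞) c

/-- `𝒜 u` for `u ∈ H²(D)`, as a function on `D` (up to null sets). -/
def DiffOperator.apply (A : DiffOperator d) (u : L2 D) (x : EuclideanSpace ℝ (Fin d)) : ℝ :=
  -(∑ i, ∑ j, A.a i j x * weakPartial j (weakPartial i u) x)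
    + ∑ i, A.b i x * weakPartial i u x + A.c x * u x

/-- `𝒜` is (uniformly) elliptic on `D`, and symmetric and positive definite on
`H²(D) ∩ H¹₀(D)` for the inner product of `L²(D)`. -/
structure DiffOperator.IsAdmissible (A : DiffOperator d)
    (D : TopologicalSpace.Opens (EuclideanSpace ℝ (Fin d))) : Prop where
  elliptic : ∃ θ : ℝ, 0 < θ ∧ ∀ x ∈ D, ∀ ξ : EuclideanSpace ℝ (Fin d),
    θ * ‖ξ‖ ^ 2 ≤ ∑ i, ∑ j, A.a i j x * ξ i * ξ j
  symmetric : ∀ u v : L2 D, MemH2 u → MemH10 u → MemH2 v → MemH10 v →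
    ∫ x in (D : Set (EuclideanSpace ℝ (Fin d))), A.apply u x * v x
      = ∫ x in (D : Set (EuclideanSpace ℝ (Fin d))), u x * A.apply v x
  posDef : ∀ u : L2 D, MemH2 u → MemH10 u → u ≠ 0 →
    0 < ∫ x in (D : Set (EuclideanSpace ℝ (Fin d))), A.apply u x * u x

/-- `(lam n, φ n)` is the Dirichlet eigensystem of `𝒜` on `D`: the eigenvalues are positive and
listed in increasing order with multiplicity, the eigenfunctions lie in `H²(D) ∩ H¹₀(D)` and
form an orthonormal basis of `L²(D)`. Indices start at `0`. -/
structure IsEigensystem (A : DiffOperator d) (lam : ℕ → ℝ) (φ : HilbertBasis ℕ ℝ (L2 D)) :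
    Prop where
  pos : ∀ n, 0 < lam n
  mono : Monotone lam
  memH2 : ∀ n, MemH2 (φ n)
  memH10 : ∀ n, MemH10 (φ n)
  eigen : ∀ n, ∀ᵐ x ∂(volume.restrict (D : Set (EuclideanSpace ℝ (Fin d)))),
    A.apply (φ n) x = lam n * φ n x

/-! ### Mittag-Leffler function -/

/-- The Mittag-Leffler function `E_{α,β}` on the real line. -/
def mittagLeffler (α β z : ℝ) : ℝ :=
  ∑' k : ℕ, z ^ k / Real.Gamma (k * α + β)

/-- The kernel `τ ↦ τ^{α-1} E_{α,α}(-μ τ^α)`. -/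
def kernel (α μ τ : ℝ) : ℝ :=
  τ ^ (α - 1) * mittagLeffler α α (-μ * τ ^ α)

/-! ### Wiener integral of a deterministic function -/

/-- A (left-open) step function `∑ cᵢ 1_{(aᵢ, bᵢ]}` on `(0, t]`. -/
structure StepFn (t : ℝ) where
  m : ℕ
  c : Fin m → ℝ
  a : Fin m → ℝ≥0
  b : Fin m → ℝ≥0
  a_le_b : ∀ i, a i ≤ b i
  b_le : ∀ i, (b i : ℝ) ≤ t

/-- The underlying function of a step function. -/
def StepFn.eval {t : ℝ} (s : StepFn t) (τ : ℝ) : ℝ :=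
  ∑ i, (Ioc (s.a i : ℝ) (s.b i)).indicator (fun _ => s.c i) τ

variable {Ω : Type*} [MeasurableSpace Ω]

/-- The Wiener integral `∑ cᵢ (W(bᵢ) - W(aᵢ))` of a step function. -/
def StepFn.wiener {t : ℝ} (s : StepFn t) (W : ℝ≥0 → Ω → ℝ) (ω : Ω) : ℝ :=
  ∑ i, s.c i * (W (s.b i) ω - W (s.a i) ω)

/-- `X` is (a version of) `∫₀ᵗ k(τ) dW(τ)`: it is the `L²(P)`-limit of the integrals of step
functions that converge to `k` in `L²(0, t)`. -/
def IsWienerIntegral (W : ℝ≥0 → Ω → ℝ) (P : Measure Ω) (t : ℝ) (k : ℝ → ℝ) (X : Ω → ℝ) : Prop :=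
  MemLp X 2 P ∧ ∃ s : ℕ → StepFn t,
    Tendsto (fun j => eLpNorm (fun τ => (s j).eval τ - k τ) 2 (volume.restrict (Ioc 0 t)))
      atTop (𝓝 0) ∧
    Tendsto (fun j => eLpNorm (fun ω => (s j).wiener W ω - X ω) 2 P) atTop (𝓝 0)

open Classical in
/-- The Wiener integral `∫₀ᵗ k(τ) dW(τ)` of a deterministic `k ∈ L²(0, t)`. It is determined
up to `P`-null sets. -/
def wienerIntegral (W : ℝ≥0 → Ω → ℝ) (P : Measure Ω) (t : ℝ) (k : ℝ → ℝ) : Ω → ℝ :=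
  if hX : ∃ X : Ω → ℝ, IsWienerIntegral W P t k X then hX.choose else 0

/-! ### The mild solution -/

/-- The deterministic part `I_{n,1}(t)`, for the coefficient `fn = ⟨f, φ_n⟩` and the
eigenvalue `μ = λ_n`. -/
def detPart (α μ fn : ℝ) (h : ℝ → ℝ) (t : ℝ) : ℝ :=
  fn * ∫ τ in (0 : ℝ)..t, kernel α μ (t - τ) * h τ

/-- The stochastic part `I_{n,2}(t)`, for the coefficient `gn = ⟨g, φ_n⟩` and the
eigenvalue `μ = λ_n`. -/
def stochPart (α μ gn : ℝ) (W : ℝ≥0 → Ω → ℝ) (P : Measure Ω) (t : ℝ) (ω : Ω) : ℝ :=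
  gn * wienerIntegral W P t (fun τ => kernel α μ (t - τ)) ω

/-- `u` is (a version of) the mild solution `∑ₙ (I_{n,1}(t) + I_{n,2}(t)) φ_n` on `[0, T]`, the
series being taken in `L²(D)`. -/
def IsMildSolution (α T : ℝ) (lam : ℕ → ℝ) (φ : HilbertBasis ℕ ℝ (L2 D)) (h : ℝ → ℝ)
    (W : ℝ≥0 → Ω → ℝ) (P : Measure Ω) (f g : L2 D) (u : ℝ → Ω → L2 D) : Prop :=
  ∀ t ∈ Icc 0 T, ∀ᵐ ω ∂P,
    u t ω = ∑' n, (detPart α (lam n) (inner ℝ f (φ n)) h t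
      + stochPart α (lam n) (inner ℝ g (φ n)) W P t ω) • φ n

/-- The random variable `u_n(t) = ⟨u(·, t), φ_n⟩`. -/
def coeff (φ : HilbertBasis ℕ ℝ (L2 D)) (u : ℝ → Ω → L2 D) (n : ℕ) (t : ℝ) (ω : Ω) : ℝ :=
  inner ℝ (u t ω) (φ n)

/-- `∫₀ᵀ τ^{α-1} E_{α,α}(-μ τ^α) h(T-τ) dτ`. -/
def meanWeight (α T μ : ℝ) (h : ℝ → ℝ) : ℝ :=
  ∫ τ in (0 : ℝ)..T, τ ^ (α - 1) * mittagLeffler α α (-μ * τ ^ α) * h (T - τ)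

/-- `∫₀ᵀ τ^{2α-2} E_{α,α}(-μ τ^α) E_{α,α}(-ν τ^α) dτ`. -/
def covWeight (α T μ ν : ℝ) : ℝ :=
  ∫ τ in (0 : ℝ)..T, τ ^ (2 * α - 2) * mittagLeffler α α (-μ * τ ^ α)
    * mittagLeffler α α (-ν * τ ^ α)

end SFDE

end

/-! Projecting the series at time `T` onto `φ n` gives, almost surely, `u_n(T) = f_n M_n + g_n X_n`,
where `X_n` is the Wiener integral of the reflected kernel (`IsMildSolution.coeff_ae_eq`). The `X_n`
are centred, and the Itô isometry gives `E[X_m X_n] = K_{m,n}`. Hence `E u_n(T) = f_n M_n` and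
`Cov(u_m(T), u_n(T)) = g_m g_n K_{m,n}`. Once the weights are nonzero, division recovers every `f_n`
and every product `g_{N₀} g_n`; since `g_{N₀} ≠ 0`, these products fix `g` up to one global sign.

Positivity of the weights reduces to `E_{α,α} > 0` on the negative half-line
(`mittagLeffler_neg_rpow_pos`). This follows from a first-zero argument in the Volterra equation
`integral_mittagLeffler`, which also yields the bound `E_{α,α} ≤ 1/Γ(α)` there. That bound dominates
all kernels by one multiple of `τ^{α-1}`, square integrable because `α > 1/2`; so the Wiener
integrals exist and the random series converges almost surely. -/

namespace SFDE

/-! ### The Mittag-Leffler function on the negative half-line -/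

/-- The Gamma function dominates every exponential. -/
lemma exp_mul_rpow_le_Gamma {R x : ℝ} (hR : 0 < R) (hx : 1 ≤ x) :
    Real.exp (-(R + 1)) * R ^ (x - 1) ≤ Real.Gamma x := by
  rw [Real.Gamma_eq_integral (by linarith)]
  have hInt := Real.GammaIntegral_convergent (s := x) (by linarith)
  have hsub : Ioc R (R + 1) ⊆ Ioi 0 := fun y hy => hR.trans hy.1
  -- Only the part of the Gamma integral over `(R, R+1]` is kept.
  calc Real.exp (-(R + 1)) * R ^ (x - 1)
      = ∫ _ in Ioc R (R + 1), Real.exp (-(R + 1)) * R ^ (x - 1) := by simp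
    _ ≤ ∫ y in Ioc R (R + 1), Real.exp (-y) * y ^ (x - 1) := by
        refine setIntegral_mono_on (integrableOn_const (by simp)) (hInt.mono_set hsub) measurableSet_Ioc
          fun y hy => ?_
        have h1 : R ^ (x - 1) ≤ y ^ (x - 1) :=
          Real.rpow_le_rpow hR.le hy.1.le (by linarith)
        have h2 : Real.exp (-(R + 1)) ≤ Real.exp (-y) := Real.exp_le_exp.2 (by linarith [hy.2])
        gcongr
    _ ≤ ∫ y in Ioi 0, Real.exp (-y) * y ^ (x - 1) := by
        refine setIntegral_mono_set hInt ?_ hsub.eventuallyLE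
        filter_upwards [ae_restrict_mem measurableSet_Ioi] with y hy
        have : (0 : ℝ) < y := hy
        simp only [Pi.zero_apply]
        positivity

/-- With `R^α = 2(|z| + 1)`, the bound `Γ(x) ≥ c R^{x-1}` dominates the terms by a geometric series
of ratio `1/2` as soon as `kα ≥ 1`. -/
lemma summable_pow_div_Gamma {α β : ℝ} (hα : 0 < α) (hβ : 0 < β) (z : ℝ) :
    Summable fun k : ℕ => |z| ^ k / Real.Gamma (k * α + β) := by
  set R : ℝ := (2 * (|z| + 1)) ^ (1 / α) with hRdef
  have hR : 0 < R := by positivity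
  have hRα : R ^ α = 2 * (|z| + 1) := by
    rw [hRdef, ← Real.rpow_mul (by positivity), one_div_mul_cancel hα.ne', Real.rpow_one]
  obtain ⟨N, hN⟩ := exists_nat_ge (1 / α)
  refine Summable.of_norm_bounded_eventually_nat
    (g := fun k : ℕ => (Real.exp (R + 1) * R ^ (1 - β)) * (1 / 2 : ℝ) ^ k)
    ((summable_geometric_of_lt_one (by norm_num) (by norm_num)).mul_left _) ?_
  filter_upwards [eventually_ge_atTop N] with k hk
  have hk1 : (1 : ℝ) ≤ k * α + β := by
    have h1 : 1 / α ≤ (k : ℝ) := hN.trans (by exact_mod_cast hk)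
    rw [div_le_iff₀ hα] at h1
    linarith
  have hG : 0 < Real.Gamma (k * α + β) := Real.Gamma_pos_of_pos (by linarith)
  rw [Real.norm_of_nonneg (by positivity), div_le_iff₀ hG]
  have hz : |z| ^ k ≤ (1 / 2 : ℝ) ^ k * (R ^ α) ^ k := by
    rw [← mul_pow, hRα]
    gcongr
    linarith [abs_nonneg z]
  refine hz.trans ?_
  have key := exp_mul_rpow_le_Gamma hR hk1
  have hpow : (R ^ α) ^ k = R ^ (1 - β) * R ^ (k * α + β - 1) := by
    rw [← Real.rpow_natCast, ← Real.rpow_mul hR.le, ← Real.rpow_add hR]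
    congr 1; ring
  have hexp : Real.exp (R + 1) * Real.exp (-(R + 1)) = 1 := by
    rw [← Real.exp_add]; simp
  calc (1 / 2 : ℝ) ^ k * (R ^ α) ^ k
      = Real.exp (R + 1) * R ^ (1 - β) * (1 / 2) ^ k
          * (Real.exp (-(R + 1)) * R ^ (k * α + β - 1)) := by
        rw [hpow]
        linear_combination (-(1 / 2 : ℝ) ^ k * R ^ (1 - β) * R ^ (k * α + β - 1)) * hexp
    _ ≤ _ := by gcongr

lemma continuous_mittagLeffler {α β : ℝ} (hα : 0 < α) (hβ : 0 < β) :
    Continuous (mittagLeffler α β) := by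
  rw [continuous_iff_continuousAt]
  intro z₀
  have hcont : ContinuousOn (mittagLeffler α β) (Metric.ball 0 (|z₀| + 1)) := by
    refine continuousOn_tsum (fun k => by fun_prop) (summable_pow_div_Gamma hα hβ (|z₀| + 1)) ?_
    intro k z hz
    have hG : 0 < Real.Gamma (k * α + β) := Real.Gamma_pos_of_pos (by positivity)
    rw [norm_div, norm_pow, Real.norm_of_nonneg hG.le]
    have h1 : ‖z‖ ≤ |(|z₀| + 1)| := by
      rw [abs_of_nonneg (by positivity)]
      exact (mem_ball_zero_iff.1 hz).le
    gcongr
  refine hcont.continuousAt (Metric.isOpen_ball.mem_nhds ?_)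
  simp

lemma mittagLeffler_zero {α β : ℝ} : mittagLeffler α β 0 = 1 / Real.Gamma β := by
  rw [mittagLeffler, tsum_eq_single 0]
  · simp
  · intro k hk; simp [hk]

/-- Euler's Beta integral rescaled to `[0, t]`, transferred from its complex form. -/
lemma integral_rpow_mul_sub_rpow {a b t : ℝ} (ha : 0 < a) (hb : 0 < b) (ht : 0 < t) :
    ∫ s in (0 : ℝ)..t, s ^ (b - 1) * (t - s) ^ (a - 1)
      = t ^ (a + b - 1) * (Real.Gamma a * Real.Gamma b / Real.Gamma (a + b)) := by
  have h := Complex.betaIntegral_scaled (b : ℂ) (a : ℂ) ht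
  rw [Complex.betaIntegral_eq_Gamma_mul_div _ _ (by simpa) (by simpa)] at h
  apply Complex.ofReal_injective
  rw [← intervalIntegral.integral_ofReal]
  have h2 : ((t ^ (a + b - 1) * (Real.Gamma a * Real.Gamma b / Real.Gamma (a + b)) : ℝ) : ℂ)
      = (t : ℂ) ^ ((b : ℂ) + a - 1)
        * (Complex.Gamma b * Complex.Gamma a / Complex.Gamma (b + a)) := by
    push_cast [Complex.ofReal_cpow ht.le, ← Complex.Gamma_ofReal]
    rw [add_comm (a : ℂ) b, mul_comm (Complex.Gamma a)]
  rw [h2, ← h]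
  refine intervalIntegral.integral_congr fun s hs => ?_
  rw [uIcc_of_le ht.le] at hs
  push_cast [Complex.ofReal_cpow hs.1, Complex.ofReal_cpow (sub_nonneg.2 hs.2)]
  rfl

/-- A non-integrable function has integral `0` by convention, whereas the Beta value is positive. -/
lemma intervalIntegrable_rpow_mul_sub_rpow {a b t : ℝ} (ha : 0 < a) (hb : 0 < b) (ht : 0 < t) :
    IntervalIntegrable (fun s => s ^ (b - 1) * (t - s) ^ (a - 1)) volume 0 t := by
  by_contra hcon
  have h1 := intervalIntegral.integral_undef hcon
  rw [integral_rpow_mul_sub_rpow ha hb ht] at h1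
  have := Real.Gamma_pos_of_pos ha
  have := Real.Gamma_pos_of_pos hb
  have := Real.Gamma_pos_of_pos (add_pos ha hb)
  have : 0 < t ^ (a + b - 1) * (Real.Gamma a * Real.Gamma b / Real.Gamma (a + b)) := by positivity
  exact this.ne' h1

/-- The Volterra equation satisfied by `t ↦ t^{α-1} E_{α,α}(-t^α)`. -/
lemma integral_mittagLeffler {α t : ℝ} (hα : 0 < α) (ht : 0 < t) :
    ∫ s in (0 : ℝ)..t, s ^ (α - 1) * (t - s) ^ (α - 1) * mittagLeffler α α (-s ^ α)
      = t ^ (α - 1) * (1 - Real.Gamma α * mittagLeffler α α (-t ^ α)) := by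
  have hΓ : ∀ k : ℕ, 0 < Real.Gamma (k * α + α) := fun k =>
    Real.Gamma_pos_of_pos (by positivity)
  have hΓα := Real.Gamma_pos_of_pos hα
  set F : ℕ → ℝ → ℝ := fun k s =>
    (-1) ^ k / Real.Gamma (k * α + α) * (s ^ ((k * α + α) - 1) * (t - s) ^ (α - 1)) with hF
  have hFeq : ∀ k, ∀ s ∈ Ioc 0 t, F k s =
      s ^ (α - 1) * (t - s) ^ (α - 1) * ((-s ^ α) ^ k / Real.Gamma (k * α + α)) := by
    intro k s hs
    have h1 : s ^ ((k * α + α) - 1) = s ^ (α - 1) * (s ^ α) ^ k := by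
      rw [← Real.rpow_natCast, ← Real.rpow_mul hs.1.le, ← Real.rpow_add hs.1]
      congr 1; ring
    simp only [hF]
    rw [h1, neg_pow (s ^ α)]
    ring
  have hpos : ∀ k : ℕ, 0 < k * α + α := fun k => by positivity
  -- Convolution with `s^{α-1}` turns the `k`-th term of the series into the `(k+1)`-st, up to
  -- constants.
  have hval : ∀ k : ℕ, ∫ s in (0 : ℝ)..t, s ^ ((k * α + α) - 1) * (t - s) ^ (α - 1)
      = t ^ (α - 1) * Real.Gamma α * Real.Gamma (k * α + α)
        * ((t ^ α) ^ (k + 1) / Real.Gamma ((k + 1 : ℕ) * α + α)) := by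
    intro k
    rw [integral_rpow_mul_sub_rpow hα (hpos k) ht]
    have h1 : t ^ (α + (k * α + α) - 1) = t ^ (α - 1) * (t ^ α) ^ (k + 1) := by
      rw [← Real.rpow_natCast, ← Real.rpow_mul ht.le, ← Real.rpow_add ht]
      congr 1; push_cast; ring
    have h2 : α + (k * α + α) = (k + 1 : ℕ) * α + α := by push_cast; ring
    rw [h1, h2]
    ring
  have hFint : ∀ k, Integrable (F k) (volume.restrict (Ioc 0 t)) := by
    intro k
    have := (intervalIntegrable_rpow_mul_sub_rpow hα (hpos k) ht).1
    exact this.const_mul _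
  have hsum1 : Summable fun k : ℕ =>
      (t ^ α) ^ (k + 1) / Real.Gamma ((k + 1 : ℕ) * α + α) := by
    have := summable_pow_div_Gamma hα hα (t ^ α)
    rw [abs_of_nonneg (by positivity)] at this
    exact (summable_nat_add_iff 1).2 this
  have hnorm : ∀ k, ∫ s in Ioc 0 t, ‖F k s‖ =
      t ^ (α - 1) * Real.Gamma α * ((t ^ α) ^ (k + 1) / Real.Gamma ((k + 1 : ℕ) * α + α)) := by
    intro k
    have h1 : ∀ s ∈ Ioc 0 t, ‖F k s‖ = 1 / Real.Gamma (k * α + α)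
        * (s ^ ((k * α + α) - 1) * (t - s) ^ (α - 1)) := by
      intro s hs
      have : 0 ≤ s ^ ((k * α + α) - 1) * (t - s) ^ (α - 1) :=
        mul_nonneg (Real.rpow_nonneg hs.1.le _) (Real.rpow_nonneg (sub_nonneg.2 hs.2) _)
      simp only [hF]
      rw [norm_mul, norm_div, norm_pow, norm_neg, norm_one, one_pow,
        Real.norm_of_nonneg (hΓ k).le, Real.norm_of_nonneg this]
    rw [setIntegral_congr_fun measurableSet_Ioc h1, integral_const_mul,
      ← intervalIntegral.integral_of_le ht.le, hval]
    have := (hΓ k).ne'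
    field_simp
  have hS := hasSum_integral_of_summable_integral_norm hFint (by
    simp_rw [hnorm]; exact hsum1.mul_left _)
  have hlhs : ∫ s in (0 : ℝ)..t, s ^ (α - 1) * (t - s) ^ (α - 1) * mittagLeffler α α (-s ^ α)
      = ∫ s in Ioc 0 t, ∑' k, F k s := by
    rw [intervalIntegral.integral_of_le ht.le]
    refine setIntegral_congr_fun measurableSet_Ioc fun s hs => ?_
    rw [tsum_congr fun k => hFeq k s hs, tsum_mul_left]
    rfl
  have hterm : ∀ k, ∫ s in Ioc 0 t, F k s = -(t ^ (α - 1) * Real.Gamma α) *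
      ((-t ^ α) ^ (k + 1) / Real.Gamma ((k + 1 : ℕ) * α + α)) := by
    intro k
    simp only [hF]
    rw [integral_const_mul, ← intervalIntegral.integral_of_le ht.le, hval, neg_pow (t ^ α)]
    have := (hΓ k).ne'
    field_simp
    ring
  have hML : mittagLeffler α α (-t ^ α) = 1 / Real.Gamma α
      + ∑' k : ℕ, (-t ^ α) ^ (k + 1) / Real.Gamma ((k + 1 : ℕ) * α + α) := by
    have hs : Summable fun k : ℕ => (-t ^ α) ^ k / Real.Gamma (k * α + α) := by
      refine Summable.of_norm ?_
      refine (summable_pow_div_Gamma hα hα (-t ^ α)).congr fun k => ?_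
      rw [norm_div, norm_pow, Real.norm_of_nonneg (hΓ k).le, Real.norm_eq_abs]
    rw [mittagLeffler, hs.tsum_eq_zero_add]
    simp
  -- The shifted series is the original one without its zeroth term `1/Γ(α)`; the sign comes from
  -- `(-1)^k = -(-1)^{k+1}`.
  rw [hlhs, ← hS.tsum_eq, tsum_congr hterm, tsum_mul_left, hML]
  field_simp
  ring

end SFDE

/-! ### Positivity and boundedness of `E_{α,α}` on the negative half-line -/

namespace SFDE

lemma continuous_mittagLeffler_neg_mul_rpow {α : ℝ} (hα : 0 < α) (μ : ℝ) :
    Continuous fun t : ℝ => mittagLeffler α α (-μ * t ^ α) :=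
  (continuous_mittagLeffler hα hα).comp
    (continuous_const.mul (Real.continuous_rpow_const hα.le))

lemma continuous_mittagLeffler_neg_rpow {α : ℝ} (hα : 0 < α) :
    Continuous fun t : ℝ => mittagLeffler α α (-t ^ α) :=
  (continuous_mittagLeffler hα hα).comp (Real.continuous_rpow_const hα.le).neg

lemma intervalIntegrable_rpow_mul_sub_rpow_mul_mittagLeffler {α t : ℝ} (hα : 0 < α) (ht : 0 < t) :
    IntervalIntegrable
      (fun s => s ^ (α - 1) * (t - s) ^ (α - 1) * mittagLeffler α α (-s ^ α)) volume 0 t :=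
  (intervalIntegrable_rpow_mul_sub_rpow hα hα ht).mul_continuousOn
    (continuous_mittagLeffler_neg_rpow hα).continuousOn

/-- Log-convexity of `t ↦ t^{α-1}`. -/
lemma sub_rpow_le_mul_sub_rpow {α s t t₀ : ℝ} (hα1 : α ≤ 1) (hs : 0 ≤ s) (hst : s < t)
    (htt : t ≤ t₀) :
    (t₀ - s) ^ (α - 1) ≤ (t₀ / t) ^ (α - 1) * (t - s) ^ (α - 1) := by
  have ht : 0 < t := hs.trans_lt hst
  have ht₀ : 0 < t₀ := ht.trans_le htt
  rw [← Real.mul_rpow (by positivity) (by linarith)]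
  -- The exponent `α - 1 ≤ 0` reverses the order, leaving `t₀ (t - s) ≤ t (t₀ - s)`.
  refine Real.rpow_le_rpow_of_nonpos (mul_pos (by positivity) (by linarith)) ?_ (by linarith)
  rw [div_mul_eq_mul_div, div_le_iff₀ ht]
  nlinarith

/-- Let `t₀` be the first point where `e(t) = E_{α,α}(-t^α)` is nonpositive. Comparing the Volterra
equations at `t < t₀` and at `t₀` bounds `e(t)` above by an integral of `e` over `[t, t₀]`. Near
`t₀` the weight of that interval is too small for this to hold at a maximum point of `e`. -/
lemma mittagLeffler_neg_rpow_pos {α : ℝ} (hα : 0 < α) (hα1 : α ≤ 1) {t : ℝ} (ht : 0 ≤ t) :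
    0 < mittagLeffler α α (-t ^ α) := by
  by_contra! hcon
  set e : ℝ → ℝ := fun t => mittagLeffler α α (-t ^ α) with he
  have hcont : Continuous e := continuous_mittagLeffler_neg_rpow hα
  have hΓ := Real.Gamma_pos_of_pos hα
  set S : Set ℝ := {t | 0 ≤ t ∧ e t ≤ 0} with hS
  have hSc : IsClosed S := isClosed_Ici.inter (isClosed_le hcont continuous_const)
  have hSb : BddBelow S := ⟨0, fun x hx => hx.1⟩
  obtain ⟨ht₀, het₀⟩ : sInf S ∈ S := hSc.csInf_mem ⟨t, ht, hcon⟩ hSb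
  set t₀ := sInf S
  have hlt : ∀ s, 0 ≤ s → s < t₀ → 0 < e s := fun s hs hst => by
    by_contra! h
    exact absurd (csInf_le hSb (show s ∈ S from ⟨hs, h⟩)) (not_le.2 hst)
  have ht₀' : 0 < t₀ := by
    -- `t₀ ≠ 0` since `e(0) = 1/Γ(α) > 0`.
    refine lt_of_le_of_ne ht₀ fun h0 => ?_
    rw [← h0] at het₀
    simp only [he, Real.zero_rpow hα.ne', neg_zero, mittagLeffler_zero] at het₀
    exact absurd het₀ (not_le.2 (by positivity))
  set w : ℝ → ℝ := fun s => s ^ (α - 1) * (t₀ - s) ^ (α - 1) with hw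
  have hwint : IntervalIntegrable w volume 0 t₀ :=
    intervalIntegrable_rpow_mul_sub_rpow hα hα ht₀'
  have hwe : IntervalIntegrable (fun s => w s * e s) volume 0 t₀ :=
    intervalIntegrable_rpow_mul_sub_rpow_mul_mittagLeffler hα ht₀'
  have hwnn : ∀ s ∈ Icc 0 t₀, 0 ≤ w s := fun s hs =>
    mul_nonneg (Real.rpow_nonneg hs.1 _) (Real.rpow_nonneg (sub_nonneg.2 hs.2) _)
  have sub1 : ∀ {c}, c ∈ Icc 0 t₀ → uIcc 0 c ⊆ uIcc 0 t₀ := fun {c} hc => by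
    rw [uIcc_of_le hc.1, uIcc_of_le ht₀]
    exact Icc_subset_Icc_right hc.2
  have sub2 : ∀ {c}, c ∈ Icc 0 t₀ → uIcc c t₀ ⊆ uIcc 0 t₀ := fun {c} hc => by
    rw [uIcc_of_le hc.2, uIcc_of_le ht₀]
    exact Icc_subset_Icc_left hc.1
  -- The full integral up to `t₀` is at least `t₀^{α-1}`, as `e(t₀) ≤ 0`; by log-convexity the part
  -- over `[0, t]` is at most `t₀^{α-1} (1 - Γ(α) e(t))`. The tail carries the difference.
  have key : ∀ t, 0 < t → t < t₀ →
      Real.Gamma α * e t * t₀ ^ (α - 1) ≤ ∫ s in t..t₀, w s * e s := by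
    intro t ht htt
    have htm : t ∈ Icc 0 t₀ := ⟨ht.le, htt.le⟩
    have h0 : ∫ s in (0 : ℝ)..t₀, w s * e s = t₀ ^ (α - 1) * (1 - Real.Gamma α * e t₀) :=
      integral_mittagLeffler hα ht₀'
    have h1 : ∫ s in (0 : ℝ)..t, s ^ (α - 1) * (t - s) ^ (α - 1) * e s
        = t ^ (α - 1) * (1 - Real.Gamma α * e t) := integral_mittagLeffler hα ht
    have h2 : ∫ s in (0 : ℝ)..t, w s * e s ≤
        ∫ s in (0 : ℝ)..t, (t₀ / t) ^ (α - 1) * (s ^ (α - 1) * (t - s) ^ (α - 1) * e s) := by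
      refine intervalIntegral.integral_mono_on_of_le_Ioo ht.le (hwe.mono_set (sub1 htm))
        ((intervalIntegrable_rpow_mul_sub_rpow_mul_mittagLeffler hα ht).const_mul _)
        fun s hs => ?_
      have h3 := sub_rpow_le_mul_sub_rpow hα1 hs.1.le hs.2 htt.le
      have h4 := hlt s hs.1.le (hs.2.trans htt)
      have h5 : 0 ≤ s ^ (α - 1) := Real.rpow_nonneg hs.1.le _
      calc w s * e s = (t₀ - s) ^ (α - 1) * (s ^ (α - 1) * e s) := by simp only [hw]; ring
        _ ≤ ((t₀ / t) ^ (α - 1) * (t - s) ^ (α - 1)) * (s ^ (α - 1) * e s) := by gcongr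
        _ = _ := by ring
    rw [intervalIntegral.integral_const_mul, h1, ← mul_assoc,
      ← Real.mul_rpow (by positivity) ht.le, div_mul_cancel₀ _ ht.ne'] at h2
    have h3 := intervalIntegral.integral_add_adjacent_intervals (hwe.mono_set (sub1 htm))
      (hwe.mono_set (sub2 htm))
    have h4 : 0 ≤ t₀ ^ (α - 1) * (Real.Gamma α * -e t₀) :=
      mul_nonneg (by positivity) (mul_nonneg hΓ.le (by linarith))
    linarith
  have htend : Tendsto (fun c => ∫ s in c..t₀, w s) (𝓝[<] t₀) (𝓝 0) := by
    have h1 : ContinuousOn (fun c => ∫ s in t₀..c, w s) (uIcc 0 t₀) :=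
      intervalIntegral.continuousOn_primitive_interval' hwint right_mem_uIcc
    have h2 : Tendsto (fun c => -∫ s in t₀..c, w s) (𝓝[Icc 0 t₀] t₀) (𝓝 0) := by
      simpa [uIcc_of_le ht₀] using (h1 t₀ right_mem_uIcc).tendsto.neg
    have h3 := h2.mono_left (nhdsWithin_mono t₀ (Ioo_subset_Icc_self (a := 0)))
    rw [nhdsWithin_Ioo_eq_nhdsLT ht₀'] at h3
    exact h3.congr fun c => (intervalIntegral.integral_symm _ _).symm
  have hpos : 0 < Real.Gamma α * t₀ ^ (α - 1) := by positivity
  obtain ⟨c, hc, hc0, hct⟩ : ∃ c, ∫ s in c..t₀, w s < Real.Gamma α * t₀ ^ (α - 1) ∧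
      0 < c ∧ c < t₀ := by
    have h1 := htend.eventually (gt_mem_nhds hpos)
    have h2 : ∀ᶠ c in 𝓝[<] t₀, c ∈ Ioo 0 t₀ := Ioo_mem_nhdsLT ht₀'
    obtain ⟨c, h1, h2⟩ := (h1.and h2).exists
    exact ⟨c, h1, h2⟩
  -- At a maximum point `t` of `e` on `[c, t₀]` the tail is at most `e(t) ∫_c^{t₀} w < Γ(α) t₀^{α-1}
  -- e(t)`, contradicting `key`.
  obtain ⟨t, htc, hmax⟩ := isCompact_Icc.exists_isMaxOn (nonempty_Icc.2 hct.le) hcont.continuousOn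
  have hec : 0 < e c := hlt c hc0.le hct
  have het : 0 < e t := hec.trans_le (hmax (left_mem_Icc.2 hct.le))
  have htt : t < t₀ := lt_of_le_of_ne htc.2 fun h => by rw [h] at het; linarith
  have ht0 : 0 < t := hc0.trans_le htc.1
  have htm : t ∈ Icc 0 t₀ := ⟨ht0.le, htt.le⟩
  have hcm : c ∈ Icc 0 t₀ := ⟨hc0.le, hct.le⟩
  have h1 : ∫ s in t..t₀, w s * e s ≤ ∫ s in t..t₀, w s * e t := by
    refine intervalIntegral.integral_mono_on htt.le (hwe.mono_set (sub2 htm))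
      ((hwint.mono_set (sub2 htm)).mul_const _) fun s hs => ?_
    exact mul_le_mul_of_nonneg_left (hmax ⟨htc.1.trans hs.1, hs.2⟩)
      (hwnn s ⟨ht0.le.trans hs.1, hs.2⟩)
  rw [intervalIntegral.integral_mul_const] at h1
  have h2 : ∫ s in t..t₀, w s ≤ ∫ s in c..t₀, w s := by
    refine intervalIntegral.integral_mono_interval htc.1 htt.le le_rfl ?_
      (hwint.mono_set (sub2 hcm))
    filter_upwards [ae_restrict_mem measurableSet_Ioc] with s hs
    exact hwnn s ⟨hc0.le.trans hs.1.le, hs.2⟩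
  have h3 := key t ht0 htt
  have h4 : (∫ s in t..t₀, w s) * e t < Real.Gamma α * t₀ ^ (α - 1) * e t :=
    mul_lt_mul_of_pos_right (h2.trans_lt hc) het
  linarith

/-- By positivity the Volterra integral is nonnegative, hence so is `1 - Γ(α) E_{α,α}(-t^α)`. -/
lemma mittagLeffler_neg_rpow_le {α : ℝ} (hα : 0 < α) (hα1 : α ≤ 1) {t : ℝ} (ht : 0 ≤ t) :
    mittagLeffler α α (-t ^ α) ≤ 1 / Real.Gamma α := by
  rcases ht.eq_or_lt with rfl | ht
  · simp [Real.zero_rpow hα.ne', mittagLeffler_zero]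
  have hΓ := Real.Gamma_pos_of_pos hα
  have h1 : 0 ≤ ∫ s in (0 : ℝ)..t,
      s ^ (α - 1) * (t - s) ^ (α - 1) * mittagLeffler α α (-s ^ α) :=
    intervalIntegral.integral_nonneg ht.le fun s hs =>
      mul_nonneg (mul_nonneg (Real.rpow_nonneg hs.1 _) (Real.rpow_nonneg (sub_nonneg.2 hs.2) _))
        (mittagLeffler_neg_rpow_pos hα hα1 hs.1).le
  rw [integral_mittagLeffler hα ht] at h1
  have h2 := nonneg_of_mul_nonneg_right h1 (by positivity)
  rw [le_div_iff₀ hΓ]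
  linarith

variable {α : ℝ}

lemma exists_rpow_eq (hα : 0 < α) {x : ℝ} (hx : 0 ≤ x) : ∃ t : ℝ, 0 ≤ t ∧ t ^ α = x :=
  ⟨x ^ α⁻¹, by positivity, Real.rpow_inv_rpow hx hα.ne'⟩

lemma mittagLeffler_neg_pos (hα : 0 < α) (hα1 : α ≤ 1) {x : ℝ} (hx : 0 ≤ x) :
    0 < mittagLeffler α α (-x) := by
  obtain ⟨t, ht, rfl⟩ := exists_rpow_eq hα hx
  exact mittagLeffler_neg_rpow_pos hα hα1 ht

lemma mittagLeffler_neg_le (hα : 0 < α) (hα1 : α ≤ 1) {x : ℝ} (hx : 0 ≤ x) :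
    mittagLeffler α α (-x) ≤ 1 / Real.Gamma α := by
  obtain ⟨t, ht, rfl⟩ := exists_rpow_eq hα hx
  exact mittagLeffler_neg_rpow_le hα hα1 ht

/-! ### The kernel -/

lemma kernel_pos (hα : 0 < α) (hα1 : α ≤ 1) {μ τ : ℝ} (hμ : 0 ≤ μ) (hτ : 0 < τ) :
    0 < kernel α μ τ := by
  rw [kernel, neg_mul]
  exact mul_pos (by positivity) (mittagLeffler_neg_pos hα hα1 (by positivity))

lemma kernel_le (hα : 0 < α) (hα1 : α ≤ 1) {μ τ : ℝ} (hμ : 0 ≤ μ) (hτ : 0 ≤ τ) :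
    kernel α μ τ ≤ τ ^ (α - 1) * (1 / Real.Gamma α) := by
  rw [kernel, neg_mul]
  exact mul_le_mul_of_nonneg_left (mittagLeffler_neg_le hα hα1 (by positivity)) (by positivity)

lemma measurable_kernel (hα : 0 < α) (μ : ℝ) : Measurable (kernel α μ) :=
  (measurable_id.pow_const _).mul (continuous_mittagLeffler_neg_mul_rpow hα μ).measurable

lemma abs_kernel_le (hα : 0 < α) (hα1 : α ≤ 1) {μ τ : ℝ} (hμ : 0 ≤ μ) (hτ : 0 < τ) :
    |kernel α μ τ| ≤ τ ^ (α - 1) * (1 / Real.Gamma α) := by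
  rw [abs_of_pos (kernel_pos hα hα1 hμ hτ)]
  exact kernel_le hα hα1 hμ hτ.le

lemma integrableOn_kernel (hα : 0 < α) (hα1 : α ≤ 1) {μ : ℝ} (hμ : 0 ≤ μ) (T : ℝ) :
    IntegrableOn (kernel α μ) (Ioc 0 T) := by
  have h1 : IntegrableOn (fun τ : ℝ => τ ^ (α - 1) * (1 / Real.Gamma α)) (Ioc 0 T) :=
    (((intervalIntegral.intervalIntegrable_rpow' (by linarith)).1).mul_const _)
  refine Integrable.mono' h1 (measurable_kernel hα μ).aestronglyMeasurable ?_
  filter_upwards [ae_restrict_mem measurableSet_Ioc] with τ hτ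
  exact abs_kernel_le hα hα1 hμ hτ.1

/-- The square has exponent `2α - 2 > -1`; this is where `α > 1/2` enters. -/
lemma memLp_rpow_sub_one (hα : 1 / 2 < α) (T : ℝ) :
    MemLp (fun τ : ℝ => τ ^ (α - 1) * (1 / Real.Gamma α)) 2 (volume.restrict (Ioc 0 T)) := by
  have h1 : IntegrableOn (fun τ : ℝ => τ ^ (2 * α - 2)) (Ioc 0 T) :=
    (intervalIntegral.intervalIntegrable_rpow' (by linarith)).1
  have hm : AEStronglyMeasurable (fun τ : ℝ => τ ^ (α - 1)) (volume.restrict (Ioc 0 T)) :=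
    (measurable_id.pow_const _).aestronglyMeasurable
  refine MemLp.mul_const ((memLp_two_iff_integrable_sq hm).2 ?_) _
  refine h1.congr_fun (fun τ hτ => ?_) measurableSet_Ioc
  simp only
  rw [← Real.rpow_mul_natCast hτ.1.le]
  congr 1; push_cast; ring

lemma memLp_kernel (hα : 1 / 2 < α) (hα1 : α ≤ 1) {μ : ℝ} (hμ : 0 ≤ μ) (T : ℝ) :
    MemLp (kernel α μ) 2 (volume.restrict (Ioc 0 T)) := by
  have hα0 : 0 < α := by linarith
  refine (memLp_rpow_sub_one hα T).of_le (measurable_kernel hα0 μ).aestronglyMeasurable ?_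
  filter_upwards [ae_restrict_mem measurableSet_Ioc] with τ hτ
  exact (abs_kernel_le hα0 hα1 hμ hτ.1).trans (le_abs_self _)

/-- Uniformity in `μ` lets one constant bound the variances of all modes in the random series. -/
lemma integral_kernel_sq_le (hα : 1 / 2 < α) (hα1 : α ≤ 1) {μ : ℝ} (hμ : 0 ≤ μ) (T : ℝ) :
    ∫ τ in Ioc 0 T, kernel α μ τ * kernel α μ τ
      ≤ ∫ τ in Ioc 0 T, (τ ^ (α - 1) * (1 / Real.Gamma α)) ^ 2 := by
  have hα0 : 0 < α := by linarith
  refine setIntegral_mono_on ?_ (memLp_rpow_sub_one hα T).integrable_sq measurableSet_Ioc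
    fun τ hτ => ?_
  · exact (memLp_kernel hα hα1 hμ T).integrable_mul (memLp_kernel hα hα1 hμ T)
  · rw [← sq]
    exact pow_le_pow_left₀ (kernel_pos hα0 hα1 hμ hτ.1).le (kernel_le hα0 hα1 hμ hτ.1.le) 2

lemma covWeight_eq {T : ℝ} (hT : 0 ≤ T) (μ ν : ℝ) :
    covWeight α T μ ν = ∫ τ in Ioc 0 T, kernel α μ τ * kernel α ν τ := by
  rw [covWeight, intervalIntegral.integral_of_le hT]
  refine setIntegral_congr_fun measurableSet_Ioc fun τ hτ => ?_
  simp only [kernel]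
  have h1 : τ ^ (2 * α - 2) = τ ^ (α - 1) * τ ^ (α - 1) := by
    rw [← Real.rpow_add hτ.1]; congr 1; ring
  rw [h1]; ring

lemma covWeight_pos (hα : 1 / 2 < α) (hα1 : α ≤ 1) {T : ℝ} (hT : 0 < T) {μ ν : ℝ} (hμ : 0 ≤ μ)
    (hν : 0 ≤ ν) : 0 < covWeight α T μ ν := by
  have hα0 : 0 < α := by linarith
  rw [covWeight_eq hT.le, ← intervalIntegral.integral_of_le hT.le]
  refine intervalIntegral.intervalIntegral_pos_of_pos_on ?_ (fun τ hτ =>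
    mul_pos (kernel_pos hα0 hα1 hμ hτ.1) (kernel_pos hα0 hα1 hν hτ.1)) hT
  rw [intervalIntegrable_iff_integrableOn_Ioc_of_le hT.le]
  exact (memLp_kernel hα hα1 hμ T).integrable_mul (memLp_kernel hα hα1 hν T)

lemma integral_kernel_sub_mul (T μ : ℝ) (h : ℝ → ℝ) :
    ∫ τ in (0 : ℝ)..T, kernel α μ (T - τ) * h τ = meanWeight α T μ h := by
  have := intervalIntegral.integral_comp_sub_left (a := 0) (b := T)
    (fun τ => kernel α μ τ * h (T - τ)) T
  simp only [sub_sub_cancel, sub_self, sub_zero] at this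
  exact this

/-- Reflection `τ ↦ T - τ` preserves Lebesgue measure on `(0, T)`. -/
lemma measurePreserving_const_sub_restrict (T : ℝ) :
    MeasurePreserving (fun τ => T - τ) (volume.restrict (Ioo 0 T))
      (volume.restrict (Ioo 0 T)) := by
  have h := (volume.measurePreserving_sub_left T).restrict_preimage (measurableSet_Ioo (a := 0)
    (b := T))
  simpa using h

/-! ### Positivity and uniform bounds for the mean weights -/

section MeanWeight

variable {T : ℝ} {h : ℝ → ℝ}

lemma intervalIntegrable_kernel_mul (hα : 0 < α) (hα1 : α ≤ 1) {μ : ℝ} (hμ : 0 ≤ μ) (hT : 0 < T)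
    (hh : MemLp h ⊤ (volume.restrict (Ioo 0 T))) :
    IntervalIntegrable (fun τ => kernel α μ τ * h (T - τ)) volume 0 T := by
  rw [intervalIntegrable_iff_integrableOn_Ioo_of_le hT.le]
  have h1 : MemLp (fun τ => h (T - τ)) ⊤ (volume.restrict (Ioo 0 T)) :=
    hh.comp_measurePreserving (measurePreserving_const_sub_restrict T)
  have h2 : IntegrableOn (kernel α μ) (Ioo 0 T) :=
    (integrableOn_kernel hα hα1 hμ T).mono_set Ioo_subset_Ioc_self
  exact Integrable.mul_of_top_left h2 h1

lemma meanWeight_pos (hα : 0 < α) (hα1 : α ≤ 1) {μ : ℝ} (hμ : 0 ≤ μ) (hT : 0 < T)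
    (hh : MemLp h ⊤ (volume.restrict (Ioo 0 T))) {c : ℝ} (hc : 0 < c)
    (hhc : ∀ᵐ t ∂(volume.restrict (Ioo 0 T)), c ≤ h t) : 0 < meanWeight α T μ h := by
  have h1 : ∀ᵐ τ ∂(volume.restrict (Ioo 0 T)), c ≤ h (T - τ) :=
    (measurePreserving_const_sub_restrict T).quasiMeasurePreserving.ae hhc
  have hk : IntervalIntegrable (kernel α μ) volume 0 T :=
    (intervalIntegrable_iff_integrableOn_Ioc_of_le hT.le).2 (integrableOn_kernel hα hα1 hμ T)
  have h2 : 0 < ∫ τ in (0 : ℝ)..T, kernel α μ τ * c :=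
    intervalIntegral.intervalIntegral_pos_of_pos_on (hk.mul_const c)
      (fun τ hτ => mul_pos (kernel_pos hα hα1 hμ hτ.1) hc) hT
  refine h2.trans_le ?_
  refine intervalIntegral.integral_mono_ae_restrict hT.le (hk.mul_const c)
    (intervalIntegrable_kernel_mul hα hα1 hμ hT hh) ?_
  rw [← restrict_Ioo_eq_restrict_Icc]
  filter_upwards [h1, ae_restrict_mem measurableSet_Ioo] with τ hτ hτ'
  exact mul_le_mul_of_nonneg_left hτ (kernel_pos hα hα1 hμ hτ'.1).le

/-- The weights `meanWeight α T μ h` are bounded uniformly in `μ ≥ 0`. -/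
lemma exists_abs_meanWeight_le (hα : 0 < α) (hα1 : α ≤ 1) (hT : 0 < T)
    (hh : MemLp h ⊤ (volume.restrict (Ioo 0 T))) :
    ∃ C, ∀ μ, 0 ≤ μ → |meanWeight α T μ h| ≤ C := by
  have h1 : MemLp (fun τ => h (T - τ)) ⊤ (volume.restrict (Ioo 0 T)) :=
    hh.comp_measurePreserving (measurePreserving_const_sub_restrict T)
  have h2 : IntegrableOn (fun τ : ℝ => τ ^ (α - 1) * (1 / Real.Gamma α)) (Ioo 0 T) :=
    IntegrableOn.mono_set ((intervalIntegral.intervalIntegrable_rpow' (by linarith)).1.mul_const _)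
      Ioo_subset_Ioc_self
  have h3 : IntegrableOn (fun τ : ℝ => τ ^ (α - 1) * (1 / Real.Gamma α) * h (T - τ)) (Ioo 0 T) :=
    Integrable.mul_of_top_left h2 h1
  refine ⟨∫ τ in Ioo 0 T, ‖τ ^ (α - 1) * (1 / Real.Gamma α) * h (T - τ)‖, fun μ hμ => ?_⟩
  rw [meanWeight, intervalIntegral.integral_of_le hT.le, integral_Ioc_eq_integral_Ioo,
    ← Real.norm_eq_abs]
  refine norm_integral_le_of_norm_le h3.norm ?_
  filter_upwards [ae_restrict_mem measurableSet_Ioo] with τ hτ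
  have h4 := mul_le_mul_of_nonneg_right
    ((abs_kernel_le hα hα1 hμ hτ.1).trans (le_abs_self _)) (norm_nonneg (h (T - τ)))
  simpa only [norm_mul, kernel, ← Real.norm_eq_abs] using h4

end MeanWeight

end SFDE

namespace SFDE

/-! ### Step functions -/

section StepFunctions

variable {t : ℝ}

lemma memLp_indicator_Ioc (t a b c : ℝ) :
    MemLp ((Ioc a b).indicator fun _ => c) 2 (volume.restrict (Ioc 0 t)) :=
  (memLp_const c).indicator measurableSet_Ioc

lemma StepFn.memLp_eval (s : StepFn t) : MemLp s.eval 2 (volume.restrict (Ioc 0 t)) := by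
  have := memLp_finsetSum (μ := volume.restrict (Ioc 0 t)) (p := 2) Finset.univ
    (f := fun i => (Ioc (s.a i : ℝ) (s.b i)).indicator fun _ => s.c i)
    fun i _ => memLp_indicator_Ioc _ _ _ _
  exact this

/-- The sum of two step functions. -/
noncomputable def StepFn.add (s r : StepFn t) : StepFn t where
  m := s.m + r.m
  c := Fin.append s.c r.c
  a := Fin.append s.a r.a
  b := Fin.append s.b r.b
  a_le_b i := by
    refine Fin.addCases (fun i => ?_) (fun i => ?_) i
    · simpa using s.a_le_b i
    · simpa using r.a_le_b i
  b_le i := by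
    refine Fin.addCases (fun i => ?_) (fun i => ?_) i
    · simpa using s.b_le i
    · simpa using r.b_le i

/-- A multiple of a step function. -/
noncomputable def StepFn.smul (x : ℝ) (s : StepFn t) : StepFn t where
  m := s.m
  c i := x * s.c i
  a := s.a
  b := s.b
  a_le_b := s.a_le_b
  b_le := s.b_le

lemma StepFn.eval_add (s r : StepFn t) : (s.add r).eval = s.eval + r.eval := by
  ext τ
  simp only [StepFn.eval, Pi.add_apply]
  exact (Fin.sum_univ_add _).trans (by simp [StepFn.add])

lemma StepFn.eval_smul (x : ℝ) (s : StepFn t) : (s.smul x).eval = x • s.eval := by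
  ext τ
  simp only [StepFn.eval, Pi.smul_apply, smul_eq_mul, Finset.mul_sum, StepFn.smul]
  refine Finset.sum_congr rfl fun i _ => ?_
  by_cases h : τ ∈ Ioc (s.a i : ℝ) (s.b i) <;> simp [h]

/-- The zero step function. -/
noncomputable def StepFn.zero (t : ℝ) : StepFn t where
  m := 0
  c := Fin.elim0
  a := Fin.elim0
  b := Fin.elim0
  a_le_b i := i.elim0
  b_le i := i.elim0

/-- The indicator of `(0, b]`. -/
noncomputable def StepFn.single (b : ℝ≥0) (hb : (b : ℝ) ≤ t) : StepFn t where
  m := 1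
  c _ := 1
  a _ := 0
  b _ := b
  a_le_b _ := zero_le
  b_le _ := hb

lemma StepFn.eval_single (b : ℝ≥0) (hb : (b : ℝ) ≤ t) (τ : ℝ) :
    (StepFn.single b hb).eval τ = (Ioc 0 (b : ℝ)).indicator 1 τ :=
  (Fin.sum_univ_one _).trans rfl

/-- A step function as an element of `L²(0, t)`. -/
noncomputable def StepFn.toL2 (s : StepFn t) : Lp ℝ 2 (volume.restrict (Ioc 0 t)) :=
  s.memLp_eval.toLp

lemma StepFn.toL2_add (s r : StepFn t) : (s.add r).toL2 = s.toL2 + r.toL2 :=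
  (MemLp.toLp_congr _ (s.memLp_eval.add r.memLp_eval) (.of_eq (s.eval_add r))).trans
    (MemLp.toLp_add _ _)

lemma StepFn.toL2_smul (x : ℝ) (s : StepFn t) : (s.smul x).toL2 = x • s.toL2 :=
  (MemLp.toLp_congr _ (s.memLp_eval.const_smul x) (.of_eq (s.eval_smul x))).trans
    (MemLp.toLp_const_smul _ _)

lemma StepFn.toL2_zero : (StepFn.zero t).toL2 = 0 := by
  rw [Lp.eq_zero_iff_ae_eq_zero]
  filter_upwards [(StepFn.zero t).memLp_eval.coeFn_toLp] with τ hτ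
  exact hτ.trans (by simp [StepFn.eval, StepFn.zero])

/-- The step functions, as a subspace of `L²(0, t)`. -/
noncomputable def stepSubmodule (t : ℝ) : Submodule ℝ (Lp ℝ 2 (volume.restrict (Ioc 0 t))) where
  carrier := range StepFn.toL2
  add_mem' := by
    rintro _ _ ⟨s, rfl⟩ ⟨r, rfl⟩
    exact ⟨s.add r, s.toL2_add r⟩
  zero_mem' := ⟨StepFn.zero t, StepFn.toL2_zero⟩
  smul_mem' := by
    rintro x _ ⟨s, rfl⟩
    exact ⟨s.smul x, s.toL2_smul x⟩

/-- An integrable function whose integrals over all initial intervals vanish is zero. -/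
lemma ae_eq_zero_of_forall_setIntegral_Iic {μ : Measure ℝ} [IsFiniteMeasure μ] {F : ℝ → ℝ}
    (hF : Integrable F μ) (huniv : ∫ x, F x ∂μ = 0) (h : ∀ b, ∫ x in Iic b, F x ∂μ = 0) :
    F =ᵐ[μ] 0 := by
  -- A π-λ argument from the half-lines `Iic b`; `huniv` handles complements.
  refine hF.ae_eq_zero_of_forall_setIntegral_eq_zero fun s hs _ => ?_
  induction s, hs using MeasurableSpace.induction_on_inter
    (borel_eq_generateFrom_Iic ℝ ▸ BorelSpace.measurable_eq) (isPiSystem_Iic) with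
  | empty => simp
  | basic s hs => obtain ⟨b, rfl⟩ := hs; exact h b
  | compl s hs ih =>
    have := integral_add_compl hs hF
    linarith [ih (measure_lt_top _ _)]
  | iUnion f hd hm ih =>
    rw [integral_iUnion hm hd hF.integrableOn]
    simp [fun i => ih i (measure_lt_top _ _)]

/-- A function orthogonal to every indicator of `(0, b]` has vanishing integrals over all initial
intervals, so the orthogonal complement is trivial. -/
lemma stepSubmodule_topologicalClosure (ht : 0 ≤ t) :
    (stepSubmodule t).topologicalClosure = ⊤ := by
  rw [Submodule.topologicalClosure_eq_top_iff, Submodule.eq_bot_iff]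
  intro F hF
  have hInt : Integrable F (volume.restrict (Ioc 0 t)) := (Lp.memLp F).integrable (by norm_num)
  have key : ∀ b : ℝ≥0, (b : ℝ) ≤ t → ∫ x in Ioc 0 (b : ℝ), F x = 0 := by
    intro b hb
    have h1 := hF _ ⟨StepFn.single b hb, rfl⟩
    rw [L2.inner_def] at h1
    have h2 : ∀ᵐ x ∂(volume.restrict (Ioc 0 t)),
        inner ℝ ((StepFn.single b hb).toL2 x) (F x) = (Ioc 0 (b : ℝ)).indicator F x := by
      filter_upwards [(StepFn.single b hb).memLp_eval.coeFn_toLp] with x hx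
      rw [StepFn.toL2, hx, StepFn.eval_single]
      by_cases h : x ∈ Ioc 0 (b : ℝ) <;> simp [h]
    rw [integral_congr_ae h2, integral_indicator measurableSet_Ioc,
      Measure.restrict_restrict measurableSet_Ioc,
      inter_eq_self_of_subset_left (Ioc_subset_Ioc_right hb)] at h1
    exact h1
  have hzero : F =ᵐ[volume.restrict (Ioc 0 t)] 0 := by
    refine ae_eq_zero_of_forall_setIntegral_Iic hInt ?_ fun b => ?_
    · exact key ⟨t, ht⟩ le_rfl
    · rw [Measure.restrict_restrict measurableSet_Iic]
      rcases le_or_gt b 0 with hb | hb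
      · rw [show Iic b ∩ Ioc 0 t = ∅ by
          ext x; simp only [mem_inter_iff, mem_Iic, mem_Ioc, mem_empty_iff_false]; grind]
        simp
      · rw [show Iic b ∩ Ioc 0 t = Ioc 0 (min b t) by
          ext x; simp only [mem_inter_iff, mem_Iic, mem_Ioc, le_min_iff]; grind]
        exact key ⟨min b t, le_min hb.le ht⟩ (min_le_right _ _)
  exact (Lp.eq_zero_iff_ae_eq_zero).2 hzero

/-- Step functions are dense in `L²(0, t)`. -/
lemma exists_stepFn_tendsto (ht : 0 ≤ t) {k : ℝ → ℝ}
    (hk : MemLp k 2 (volume.restrict (Ioc 0 t))) :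
    ∃ s : ℕ → StepFn t, Tendsto (fun j => (s j).toL2) atTop (𝓝 hk.toLp) := by
  have h1 : hk.toLp ∈ closure (stepSubmodule t : Set (Lp ℝ 2 (volume.restrict (Ioc 0 t)))) := by
    rw [← Submodule.topologicalClosure_coe, stepSubmodule_topologicalClosure ht]
    trivial
  obtain ⟨x, hx, hlim⟩ := mem_closure_iff_seq_limit.1 h1
  choose s hs using hx
  exact ⟨s, by simpa only [hs] using hlim⟩

end StepFunctions

/-! ### The Wiener integral -/

section Wiener

variable {Ω : Type*} [MeasurableSpace Ω] {P : Measure Ω} {W : ℝ≥0 → Ω → ℝ} {t : ℝ}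

lemma memLp_two_of_isPreBrownianReal (hW : IsPreBrownianReal W P) (x : ℝ≥0) :
    MemLp (W x) 2 P :=
  (hW.isGaussianProcess.hasGaussianLaw_eval x).memLp_two

lemma StepFn.memLp_wiener (hW : IsPreBrownianReal W P) (s : StepFn t) :
    MemLp (s.wiener W) 2 P := by
  have := memLp_finsetSum (μ := P) (p := 2) Finset.univ
    (f := fun i ω => s.c i * (W (s.b i) ω - W (s.a i) ω))
    fun i _ => ((memLp_two_of_isPreBrownianReal hW _).sub
      (memLp_two_of_isPreBrownianReal hW _)).const_mul _
  exact this

lemma StepFn.integral_wiener (hW : IsPreBrownianReal W P) (s : StepFn t) :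
    ∫ ω, s.wiener W ω ∂P = 0 := by
  have hi : ∀ x, Integrable (W x) P := hW.integrable_eval
  have hi' : ∀ (x y : ℝ≥0) (c : ℝ), Integrable (fun ω => c * (W x ω - W y ω)) P :=
    fun x y c => ((hi x).sub (hi y)).const_mul c
  have h0 : ∀ x, ∫ ω, W x ω ∂P = 0 := hW.integral_eval
  simp only [StepFn.wiener]
  rw [integral_finsetSum _ fun i _ => hi' _ _ _]
  refine Finset.sum_eq_zero fun i _ => ?_
  rw [integral_const_mul, integral_sub (hi _) (hi _), h0, h0]
  simp

/-- The overlap length is written with four minima to match the Brownian covariance `min x y`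
expanded over two increments. -/
lemma integral_indicator_Ioc_mul_indicator_Ioc {a b a' b' : ℝ≥0} (hab : a ≤ b) (hab' : a' ≤ b')
    (hb : (b : ℝ) ≤ t) (c c' : ℝ) :
    ∫ τ in Ioc 0 t, (Ioc (a : ℝ) b).indicator (fun _ => c) τ
        * (Ioc (a' : ℝ) b').indicator (fun _ => c') τ
      = c * c' * (min b b' - min b a' - (min a b' - min a a') : ℝ) := by
  have h1 : ∀ τ : ℝ, (Ioc (a : ℝ) b).indicator (fun _ => c) τ
        * (Ioc (a' : ℝ) b').indicator (fun _ => c') τ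
      = (Ioc (a : ℝ) b ∩ Ioc (a' : ℝ) b').indicator (fun _ => c * c') τ := by
    intro τ
    rw [inter_indicator_mul]
  simp_rw [h1]
  rw [integral_indicator (measurableSet_Ioc.inter measurableSet_Ioc),
    Measure.restrict_restrict (measurableSet_Ioc.inter measurableSet_Ioc),
    inter_eq_self_of_subset_left (inter_subset_left.trans
      (Ioc_subset_Ioc a.coe_nonneg hb)), Ioc_inter_Ioc, setIntegral_const, Real.volume_real_Ioc,
      smul_eq_mul, mul_comm]
  congr 1
  have h2 : (a : ℝ) ≤ b := hab
  have h3 : (a' : ℝ) ≤ b' := hab'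
  push_cast
  grind

lemma integral_mul_increments (hW : IsPreBrownianReal W P) (a b a' b' : ℝ≥0) (c c' : ℝ) :
    ∫ ω, (c * (W b ω - W a ω)) * (c' * (W b' ω - W a' ω)) ∂P
      = c * c' * (min b b' - min b a' - (min a b' - min a a') : ℝ) := by
  have : IsProbabilityMeasure P := hW.isGaussianProcess.isProbabilityMeasure
  have hm := memLp_two_of_isPreBrownianReal hW
  have hmul : ∀ x y, ∫ ω, W x ω * W y ω ∂P = min (x : ℝ) y := by
    intro x y
    have h1 := covariance_eq_sub (hm x) (hm y)
    rw [hW.covariance_eval, hW.integral_eval] at h1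
    simpa using h1.symm
  have hInt : ∀ x y, Integrable (fun ω => W x ω * W y ω) P := fun x y =>
    (hm x).integrable_mul (hm y)
  have hInt' : ∀ x y z, Integrable (fun ω => W x ω * W y ω - W x ω * W z ω) P := fun x y z =>
    (hInt x y).sub (hInt x z)
  have h2 : ∀ ω, (c * (W b ω - W a ω)) * (c' * (W b' ω - W a' ω))
      = c * c' * ((W b ω * W b' ω - W b ω * W a' ω) - (W a ω * W b' ω - W a ω * W a' ω)) := by
    intro ω; ring
  simp_rw [h2]
  rw [integral_const_mul, integral_sub (hInt' _ _ _) (hInt' _ _ _),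
    integral_sub (hInt _ _) (hInt _ _), integral_sub (hInt _ _) (hInt _ _)]
  simp only [hmul, NNReal.coe_min]

/-- The isometry property for step functions. -/
lemma StepFn.integral_wiener_mul_wiener (hW : IsPreBrownianReal W P) (s r : StepFn t) :
    ∫ ω, s.wiener W ω * r.wiener W ω ∂P = ∫ τ in Ioc 0 t, s.eval τ * r.eval τ := by
  have hm : ∀ (a b : ℝ≥0) (c : ℝ), MemLp (fun ω => c * (W b ω - W a ω)) 2 P := fun a b c =>
    ((memLp_two_of_isPreBrownianReal hW b).sub (memLp_two_of_isPreBrownianReal hW a)).const_mul c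
  have hm1 : ∀ i j, Integrable (fun ω => (s.c i * (W (s.b i) ω - W (s.a i) ω))
      * (r.c j * (W (r.b j) ω - W (r.a j) ω))) P := fun i j =>
    (hm _ _ _).integrable_mul (hm _ _ _)
  have hm2 : ∀ i j, IntegrableOn (fun τ => (Ioc (s.a i : ℝ) (s.b i)).indicator (fun _ => s.c i) τ
      * (Ioc (r.a j : ℝ) (r.b j)).indicator (fun _ => r.c j) τ) (Ioc 0 t) := fun i j =>
    (memLp_indicator_Ioc t _ _ _).integrable_mul (memLp_indicator_Ioc t _ _ _)
  simp only [StepFn.wiener, StepFn.eval, Finset.sum_mul_sum]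
  rw [integral_finsetSum _ fun i _ => integrable_finsetSum _ fun j _ => hm1 i j,
    integral_finsetSum _ fun i _ => integrable_finsetSum _ fun j _ => hm2 i j]
  refine Finset.sum_congr rfl fun i _ => ?_
  rw [integral_finsetSum _ fun j _ => hm1 i j, integral_finsetSum _ fun j _ => hm2 i j]
  refine Finset.sum_congr rfl fun j _ => ?_
  rw [integral_mul_increments hW,
    integral_indicator_Ioc_mul_indicator_Ioc (s.a_le_b i) (r.a_le_b j) (s.b_le i)]

lemma inner_toLp_eq_integral {X : Type*} [MeasurableSpace X] {μ : Measure X} {F G : X → ℝ}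
    (hF : MemLp F 2 μ) (hG : MemLp G 2 μ) :
    inner ℝ hF.toLp hG.toLp = ∫ x, F x * G x ∂μ := by
  rw [L2.inner_def]
  refine integral_congr_ae ?_
  filter_upwards [hF.coeFn_toLp, hG.coeFn_toLp] with x h1 h2
  simp [h1, h2, mul_comm]

/-- The Wiener integral of a step function as an element of `L²(P)`. -/
noncomputable def StepFn.wienerL2 (hW : IsPreBrownianReal W P) (s : StepFn t) : Lp ℝ 2 P :=
  (s.memLp_wiener hW).toLp

lemma StepFn.inner_wienerL2 (hW : IsPreBrownianReal W P) (s r : StepFn t) :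
    inner ℝ (s.wienerL2 hW) (r.wienerL2 hW) = inner ℝ s.toL2 r.toL2 :=
  (inner_toLp_eq_integral _ _).trans
    ((s.integral_wiener_mul_wiener hW r).trans (inner_toLp_eq_integral _ _).symm)

/-- Transfers the Cauchy property from integrands to their Wiener integrals. -/
lemma StepFn.dist_wienerL2 (hW : IsPreBrownianReal W P) (s r : StepFn t) :
    dist (s.wienerL2 hW) (r.wienerL2 hW) = dist s.toL2 r.toL2 := by
  rw [dist_eq_norm, dist_eq_norm, ← sq_eq_sq₀ (norm_nonneg _) (norm_nonneg _),
    ← real_inner_self_eq_norm_sq, ← real_inner_self_eq_norm_sq]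
  simp only [inner_sub_left, inner_sub_right, StepFn.inner_wienerL2]

/-- Every square integrable deterministic function has a Wiener integral. -/
lemma exists_isWienerIntegral (hW : IsPreBrownianReal W P) (ht : 0 ≤ t) {k : ℝ → ℝ}
    (hk : MemLp k 2 (volume.restrict (Ioc 0 t))) : ∃ X, IsWienerIntegral W P t k X := by
  obtain ⟨s, hs⟩ := exists_stepFn_tendsto ht hk
  have hcauchy : CauchySeq fun j => (s j).wienerL2 hW := by
    have h1 := hs.cauchySeq
    rw [Metric.cauchySeq_iff] at h1 ⊢
    simpa only [StepFn.dist_wienerL2] using h1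
  obtain ⟨X, hX⟩ := cauchySeq_tendsto_of_complete hcauchy
  refine ⟨X, Lp.memLp X, s, ?_, ?_⟩
  · exact (Lp.tendsto_Lp_iff_tendsto_eLpNorm'' _ (fun j => (s j).memLp_eval) _ hk).1 hs
  · rw [← Lp.toLp_coeFn X (Lp.memLp X)] at hX
    exact (Lp.tendsto_Lp_iff_tendsto_eLpNorm'' _ (fun j => (s j).memLp_wiener hW) _
      (Lp.memLp X)).1 hX

lemma isWienerIntegral_wienerIntegral (hW : IsPreBrownianReal W P) (ht : 0 ≤ t) {k : ℝ → ℝ}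
    (hk : MemLp k 2 (volume.restrict (Ioc 0 t))) :
    IsWienerIntegral W P t k (wienerIntegral W P t k) := by
  have h := exists_isWienerIntegral hW ht hk
  rw [wienerIntegral, dif_pos h]
  exact h.choose_spec

namespace IsWienerIntegral

variable {k l : ℝ → ℝ} {X Y : Ω → ℝ}

lemma exists_tendsto_toLp (hW : IsPreBrownianReal W P) (hX : IsWienerIntegral W P t k X)
    (hk : MemLp k 2 (volume.restrict (Ioc 0 t))) : ∃ s : ℕ → StepFn t,
      Tendsto (fun j => (s j).toL2) atTop (𝓝 hk.toLp) ∧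
      Tendsto (fun j => (s j).wienerL2 hW) atTop (𝓝 hX.1.toLp) := by
  obtain ⟨s, h1, h2⟩ := hX.2
  exact ⟨s, (Lp.tendsto_Lp_iff_tendsto_eLpNorm'' _ (fun j => (s j).memLp_eval) _ hk).2 h1,
    (Lp.tendsto_Lp_iff_tendsto_eLpNorm'' _ (fun j => (s j).memLp_wiener hW) _ hX.1).2 h2⟩

/-- The Itô isometry for deterministic integrands. -/
lemma integral_mul (hW : IsPreBrownianReal W P) (hX : IsWienerIntegral W P t k X)
    (hY : IsWienerIntegral W P t l Y) (hk : MemLp k 2 (volume.restrict (Ioc 0 t)))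
    (hl : MemLp l 2 (volume.restrict (Ioc 0 t))) :
    ∫ ω, X ω * Y ω ∂P = ∫ τ in Ioc 0 t, k τ * l τ := by
  obtain ⟨s, hs1, hs2⟩ := hX.exists_tendsto_toLp hW hk
  obtain ⟨r, hr1, hr2⟩ := hY.exists_tendsto_toLp hW hl
  rw [← inner_toLp_eq_integral hX.1 hY.1, ← inner_toLp_eq_integral hk hl]
  -- By the step-function isometry both sides are limits of the same sequence of inner products.
  refine tendsto_nhds_unique (hs2.inner (𝕜 := ℝ) hr2) ?_
  simp only [StepFn.inner_wienerL2]
  exact hs1.inner hr1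

/-- The mean is the `L²` pairing with the constant `1`, which is continuous and vanishes on step
integrals. -/
lemma integral_eq_zero (hW : IsPreBrownianReal W P) (hX : IsWienerIntegral W P t k X)
    (hk : MemLp k 2 (volume.restrict (Ioc 0 t))) : ∫ ω, X ω ∂P = 0 := by
  have : IsProbabilityMeasure P := hW.isGaussianProcess.isProbabilityMeasure
  obtain ⟨s, -, hs⟩ := hX.exists_tendsto_toLp hW hk
  have h1 : MemLp (fun _ : Ω => (1 : ℝ)) 2 P := memLp_const 1
  have h2 := hs.inner (𝕜 := ℝ) (tendsto_const_nhds (x := h1.toLp))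
  have h3 : ∀ j, inner ℝ ((s j).wienerL2 hW) h1.toLp = 0 := fun j =>
    (inner_toLp_eq_integral _ _).trans (by simpa using (s j).integral_wiener hW)
  have h4 := tendsto_nhds_unique (h2.congr h3) tendsto_const_nhds
  rw [inner_toLp_eq_integral] at h4
  simpa using h4

end IsWienerIntegral

end Wiener

end SFDE

namespace SFDE

/-! ### The coefficients of the mild solution -/

section HilbertBasis

variable {E : Type*} [NormedAddCommGroup E] [InnerProductSpace ℝ E]

/-- Square summability guarantees convergence; otherwise `tsum` could take its default value `0`. -/
lemma inner_tsum_smul_hilbertBasis (b : HilbertBasis ℕ ℝ E) {c : ℕ → ℝ}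
    (hc : Summable fun n => c n ^ 2) (m : ℕ) : inner ℝ (∑' n, c n • b n) (b m) = c m := by
  have hmem : Memℓp c 2 := by
    refine memℓp_gen ?_
    simpa using hc
  have h1 := b.hasSum_repr_symm ⟨c, hmem⟩
  rw [h1.tsum_eq, real_inner_comm, ← b.repr_apply_apply, LinearIsometryEquiv.apply_symm_apply]

lemma summable_inner_hilbertBasis_sq (b : HilbertBasis ℕ ℝ E) (x : E) :
    Summable fun n => inner ℝ x (b n) ^ 2 := by
  refine (b.summable_inner_mul_inner x x).congr fun n => ?_
  rw [real_inner_comm x (b n), sq]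

lemma hilbertBasis_ext (b : HilbertBasis ℕ ℝ E) {x y : E}
    (h : ∀ n, inner ℝ x (b n) = inner ℝ y (b n)) : x = y := by
  refine b.repr.injective ?_
  ext n
  rw [b.repr_apply_apply, b.repr_apply_apply, real_inner_comm, real_inner_comm y, h n]

end HilbertBasis

variable {d : ℕ} {D : TopologicalSpace.Opens (EuclideanSpace ℝ (Fin d))}
  {Ω : Type*} [MeasurableSpace Ω] {P : Measure Ω} {W : ℝ≥0 → Ω → ℝ}
  {lam : ℕ → ℝ} {φ : HilbertBasis ℕ ℝ (L2 D)} {α T : ℝ} {h : ℝ → ℝ}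

/-- The stochastic convolution `∫₀ᵀ (T-τ)^{α-1} E_{α,α}(-μ (T-τ)^α) dW(τ)`. -/
noncomputable def stochConv (W : ℝ≥0 → Ω → ℝ) (P : Measure Ω) (α T μ : ℝ) : Ω → ℝ :=
  wienerIntegral W P T fun τ => kernel α μ (T - τ)

lemma memLp_kernel_sub (hα : 1 / 2 < α) (hα1 : α ≤ 1) {μ : ℝ} (hμ : 0 ≤ μ) (T : ℝ) :
    MemLp (fun τ => kernel α μ (T - τ)) 2 (volume.restrict (Ioc 0 T)) := by
  have h1 := memLp_kernel hα hα1 hμ T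
  -- The reflection preserves the open interval but not the half-open one.
  rw [← restrict_Ioo_eq_restrict_Ioc] at h1 ⊢
  exact h1.comp_measurePreserving (measurePreserving_const_sub_restrict T)

lemma isWienerIntegral_stochConv (hW : IsPreBrownianReal W P) (hα : 1 / 2 < α) (hα1 : α ≤ 1)
    (hT : 0 ≤ T) {μ : ℝ} (hμ : 0 ≤ μ) :
    IsWienerIntegral W P T (fun τ => kernel α μ (T - τ)) (stochConv W P α T μ) :=
  isWienerIntegral_wienerIntegral hW hT (memLp_kernel_sub hα hα1 hμ T)

lemma integral_stochConv (hW : IsPreBrownianReal W P) (hα : 1 / 2 < α) (hα1 : α ≤ 1)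
    (hT : 0 ≤ T) {μ : ℝ} (hμ : 0 ≤ μ) : ∫ ω, stochConv W P α T μ ω ∂P = 0 :=
  (isWienerIntegral_stochConv hW hα hα1 hT hμ).integral_eq_zero hW (memLp_kernel_sub hα hα1 hμ T)

lemma integral_stochConv_mul (hW : IsPreBrownianReal W P) (hα : 1 / 2 < α) (hα1 : α ≤ 1)
    (hT : 0 ≤ T) {μ ν : ℝ} (hμ : 0 ≤ μ) (hν : 0 ≤ ν) :
    ∫ ω, stochConv W P α T μ ω * stochConv W P α T ν ω ∂P = covWeight α T μ ν := by
  rw [(isWienerIntegral_stochConv hW hα hα1 hT hμ).integral_mul hW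
    (isWienerIntegral_stochConv hW hα hα1 hT hν) (memLp_kernel_sub hα hα1 hμ T)
    (memLp_kernel_sub hα hα1 hν T), covWeight_eq hT, ← intervalIntegral.integral_of_le hT,
    ← intervalIntegral.integral_of_le hT]
  simpa using intervalIntegral.integral_comp_sub_left (a := 0) (b := T)
    (fun τ => kernel α μ τ * kernel α ν τ) T

/-- Almost surely the stochastic coefficients are square summable. -/
lemma ae_summable_sq_mul_stochConv (hW : IsPreBrownianReal W P) (hα : 1 / 2 < α) (hα1 : α ≤ 1)
    (hT : 0 ≤ T) (hlam : ∀ n, 0 ≤ lam n) {c : ℕ → ℝ} (hc : Summable fun n => c n ^ 2) :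
    ∀ᵐ ω ∂P, Summable fun n => (c n * stochConv W P α T (lam n) ω) ^ 2 := by
  set C := ∫ τ in Ioc 0 T, (τ ^ (α - 1) * (1 / Real.Gamma α)) ^ 2 with hC
  have hmem : ∀ n, MemLp (fun ω => c n * stochConv W P α T (lam n) ω) 2 P := fun n =>
    (isWienerIntegral_stochConv hW hα hα1 hT (hlam n)).1.const_mul (c n)
  have hval : ∀ n, ∫ ω, (c n * stochConv W P α T (lam n) ω) ^ 2 ∂P
      = c n ^ 2 * covWeight α T (lam n) (lam n) := fun n => by
    rw [← integral_stochConv_mul hW hα hα1 hT (hlam n) (hlam n), ← integral_const_mul]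
    congr 1 with ω
    ring
  have hle : ∀ n, c n ^ 2 * covWeight α T (lam n) (lam n) ≤ c n ^ 2 * C := fun n => by
    rw [covWeight_eq hT]
    exact mul_le_mul_of_nonneg_left (integral_kernel_sq_le hα hα1 (hlam n) T) (sq_nonneg _)
  -- The second moments sum to at most `C ∑ c_n²`; by Tonelli the random sum of squares has finite
  -- expectation, so it is almost surely finite.
  have hfin : ∑' n, ∫⁻ ω, ENNReal.ofReal ((c n * stochConv W P α T (lam n) ω) ^ 2) ∂P ≠ ⊤ := by
    have h1 : ∀ n, ∫⁻ ω, ENNReal.ofReal ((c n * stochConv W P α T (lam n) ω) ^ 2) ∂P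
        ≤ ENNReal.ofReal (c n ^ 2 * C) := fun n => by
      rw [← ofReal_integral_eq_lintegral_ofReal (hmem n).integrable_sq
        (Eventually.of_forall fun ω => sq_nonneg _), hval]
      exact ENNReal.ofReal_le_ofReal (hle n)
    exact ne_top_of_le_ne_top (hc.mul_right C).tsum_ofReal_ne_top (ENNReal.tsum_le_tsum h1)
  have hmeas : ∀ n, AEMeasurable
      (fun ω => ENNReal.ofReal ((c n * stochConv W P α T (lam n) ω) ^ 2)) P := fun n =>
    (hmem n).aestronglyMeasurable.aemeasurable.pow_const 2 |>.ennreal_ofReal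
  rw [← lintegral_tsum hmeas] at hfin
  filter_upwards [ae_lt_top' (AEMeasurable.tsum hmeas) hfin] with ω hω
  have h2 := ENNReal.summable_toReal hω.ne
  simpa only [ENNReal.toReal_ofReal (sq_nonneg _)] using h2

/-! ### Mean and covariance of the solution coefficients -/

section Solution

variable {f g : L2 D} {u : ℝ → Ω → L2 D}

/-- Deterministic and stochastic coefficients are both almost surely square summable, so the series
converges and orthonormality isolates its `n`-th coefficient. -/
lemma IsMildSolution.coeff_ae_eq (hu : IsMildSolution α T lam φ h W P f g u)
    (hW : IsPreBrownianReal W P) (hα : 1 / 2 < α) (hα1 : α ≤ 1) (hT : 0 < T)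
    (hlam : ∀ n, 0 ≤ lam n) (hh : MemLp h ⊤ (volume.restrict (Ioo 0 T))) (n : ℕ) :
    coeff φ u n T =ᵐ[P] fun ω => inner ℝ f (φ n) * meanWeight α T (lam n) h
      + inner ℝ g (φ n) * stochConv W P α T (lam n) ω := by
  obtain ⟨C, hC⟩ := exists_abs_meanWeight_le (α := α) (by linarith) hα1 hT hh
  have hdet : Summable fun n => (inner ℝ f (φ n) * meanWeight α T (lam n) h) ^ 2 := by
    refine Summable.of_nonneg_of_le (fun n => sq_nonneg _) (fun n => ?_)
      ((summable_inner_hilbertBasis_sq φ f).mul_right (C ^ 2))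
    rw [mul_pow]
    exact mul_le_mul_of_nonneg_left (sq_le_sq' (abs_le.1 (hC _ (hlam n))).1
      (abs_le.1 (hC _ (hlam n))).2) (sq_nonneg _)
  filter_upwards [hu T ⟨hT.le, le_rfl⟩, ae_summable_sq_mul_stochConv hW hα hα1 hT.le hlam
    (summable_inner_hilbertBasis_sq φ g)] with ω hω hsum
  rw [coeff, hω]
  simp only [detPart, stochPart, integral_kernel_sub_mul]
  refine inner_tsum_smul_hilbertBasis φ ?_ n
  refine Summable.of_nonneg_of_le (fun n => sq_nonneg _) (fun n => ?_)
    ((hdet.mul_left 2).add (hsum.mul_left 2))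
  rw [← mul_add]
  exact add_sq_le

variable [IsProbabilityMeasure P]

lemma IsMildSolution.memLp_coeff (hu : IsMildSolution α T lam φ h W P f g u)
    (hW : IsPreBrownianReal W P) (hα : 1 / 2 < α) (hα1 : α ≤ 1) (hT : 0 < T)
    (hlam : ∀ n, 0 ≤ lam n) (hh : MemLp h ⊤ (volume.restrict (Ioo 0 T))) (n : ℕ) :
    MemLp (coeff φ u n T) 2 P := by
  rw [memLp_congr_ae (hu.coeff_ae_eq hW hα hα1 hT hlam hh n)]
  have h1 := (isWienerIntegral_stochConv hW hα hα1 hT.le (hlam n)).1.const_mul (inner ℝ g (φ n))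
  exact (memLp_const (inner ℝ f (φ n) * meanWeight α T (lam n) h)).add h1

lemma IsMildSolution.integral_coeff (hu : IsMildSolution α T lam φ h W P f g u)
    (hW : IsPreBrownianReal W P) (hα : 1 / 2 < α) (hα1 : α ≤ 1) (hT : 0 < T)
    (hlam : ∀ n, 0 ≤ lam n) (hh : MemLp h ⊤ (volume.restrict (Ioo 0 T))) (n : ℕ) :
    P[coeff φ u n T] = inner ℝ f (φ n) * meanWeight α T (lam n) h := by
  have hX := (isWienerIntegral_stochConv hW hα hα1 hT.le (hlam n)).1.integrable (by norm_num)
  rw [integral_congr_ae (hu.coeff_ae_eq hW hα hα1 hT hlam hh n),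
    integral_add (integrable_const _) (hX.const_mul _),
    integral_const_mul (inner ℝ g (φ n)), integral_stochConv hW hα hα1 hT.le (hlam n)]
  simp

/-- Centring removes the deterministic part; the rest is the Itô isometry. -/
lemma IsMildSolution.covariance_coeff (hu : IsMildSolution α T lam φ h W P f g u)
    (hW : IsPreBrownianReal W P) (hα : 1 / 2 < α) (hα1 : α ≤ 1) (hT : 0 < T)
    (hlam : ∀ n, 0 ≤ lam n) (hh : MemLp h ⊤ (volume.restrict (Ioo 0 T))) (m n : ℕ) :
    cov[coeff φ u m T, coeff φ u n T; P]
      = inner ℝ g (φ m) * inner ℝ g (φ n) * covWeight α T (lam m) (lam n) := by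
  have hci : ∀ n, P[coeff φ u n T] = inner ℝ f (φ n) * meanWeight α T (lam n) h :=
    hu.integral_coeff hW hα hα1 hT hlam hh
  rw [covariance, hci, hci, ← integral_stochConv_mul hW hα hα1 hT.le (hlam m) (hlam n),
    ← integral_const_mul]
  refine integral_congr_ae ?_
  filter_upwards [hu.coeff_ae_eq hW hα hα1 hT hlam hh m,
    hu.coeff_ae_eq hW hα hα1 hT hlam hh n] with ω h1 h2
  rw [h1, h2]
  ring

lemma IsMildSolution.variance_coeff (hu : IsMildSolution α T lam φ h W P f g u)
    (hW : IsPreBrownianReal W P) (hα : 1 / 2 < α) (hα1 : α ≤ 1) (hT : 0 < T)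
    (hlam : ∀ n, 0 ≤ lam n) (hh : MemLp h ⊤ (volume.restrict (Ioo 0 T))) (n : ℕ) :
    Var[coeff φ u n T; P] = inner ℝ g (φ n) ^ 2 * covWeight α T (lam n) (lam n) := by
  rw [← covariance_self (hu.memLp_coeff hW hα hα1 hT hlam hh n).aestronglyMeasurable.aemeasurable,
    hu.covariance_coeff hW hα hα1 hT hlam hh, sq]

end Solution

end SFDE

/-! ### Recovery formulas and uniqueness -/

theorem theorem2 {d : ℕ} (D : TopologicalSpace.Opens (EuclideanSpace ℝ (Fin d)))
    (hD : Bornology.IsBounded (D : Set (EuclideanSpace ℝ (Fin d))))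
    (A : SFDE.DiffOperator d) (hA : A.IsAdmissible D)
    (lam : ℕ → ℝ) (φ : HilbertBasis ℕ ℝ (SFDE.L2 D)) (hφ : SFDE.IsEigensystem A lam φ)
    (α T : ℝ) (hα : α ∈ Ioo (1 / 2 : ℝ) 1) (hT : 0 < T)
    (h : ℝ → ℝ) (hh : MemLp h ⊤ (volume.restrict (Ioo 0 T)))
    (c_h : ℝ) (hc : 0 < c_h) (hhc : ∀ᵐ t ∂(volume.restrict (Ioo 0 T)), c_h ≤ h t)
    {Ω : Type*} [MeasurableSpace Ω] (P : Measure Ω) [IsProbabilityMeasure P]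
    (W : ℝ≥0 → Ω → ℝ) (hW : IsBrownianReal W P)
    (f g : SFDE.L2 D) (hg0 : g ≠ 0) (hg : SFDE.MemH2 g)
    (N₀ : ℕ) (hN₀ : inner ℝ g (φ N₀) ≠ 0)
    (u : ℝ → Ω → SFDE.L2 D) (hu : SFDE.IsMildSolution α T lam φ h W P f g u) :
    -- the data are well defined
    (∀ n, MemLp (SFDE.coeff φ u n T) 2 P) ∧
    -- coefficient-wise recovery of `f`
    (∀ n, 0 < SFDE.meanWeight α T (lam n) h ∧
      inner ℝ f (φ n) = P[SFDE.coeff φ u n T] / SFDE.meanWeight α T (lam n) h) ∧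
    -- coefficient-wise recovery of `g` up to a global sign
    (∀ n, 0 < SFDE.covWeight α T (lam N₀) (lam n)) ∧
    0 < Var[SFDE.coeff φ u N₀ T; P] ∧
    |inner ℝ g (φ N₀)| =
      √(Var[SFDE.coeff φ u N₀ T; P] / SFDE.covWeight α T (lam N₀) (lam N₀)) ∧
    (∃ s : ℝ, (s = 1 ∨ s = -1) ∧ ∀ n, s * inner ℝ g (φ n) =
      cov[SFDE.coeff φ u N₀ T, SFDE.coeff φ u n T; P] /
        (√(Var[SFDE.coeff φ u N₀ T; P] / SFDE.covWeight α T (lam N₀) (lam N₀))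
          * SFDE.covWeight α T (lam N₀) (lam n))) ∧
    -- uniqueness: sources with the same data have the same `f` and the same `|g|`,
    -- and indeed the same `g` up to a global sign
    (∀ (f' g' : SFDE.L2 D) (u' : ℝ → Ω → SFDE.L2 D), SFDE.MemH2 g' →
      SFDE.IsMildSolution α T lam φ h W P f' g' u' →
      (∀ n, P[SFDE.coeff φ u' n T] = P[SFDE.coeff φ u n T]) →
      Var[SFDE.coeff φ u' N₀ T; P] = Var[SFDE.coeff φ u N₀ T; P] →
      (∀ n, cov[SFDE.coeff φ u' N₀ T, SFDE.coeff φ u' n T; P]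
        = cov[SFDE.coeff φ u N₀ T, SFDE.coeff φ u n T; P]) →
      f' = f ∧ (g' = g ∨ g' = -g) ∧ |g'| = |g|) := by
  obtain ⟨hα, hα1⟩ := hα
  replace hα1 := hα1.le
  have hW' : IsPreBrownianReal W P := hW.toIsPreBrownianReal
  have hlam : ∀ n, 0 ≤ lam n := fun n => (hφ.pos n).le
  have hM : ∀ n, 0 < SFDE.meanWeight α T (lam n) h := fun n =>
    SFDE.meanWeight_pos (by linarith) hα1 (hlam n) hT hh hc hhc
  have hK : ∀ m n, 0 < SFDE.covWeight α T (lam m) (lam n) := fun m n =>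
    SFDE.covWeight_pos hα hα1 hT (hlam m) (hlam n)
  have hmean := hu.integral_coeff hW' hα hα1 hT hlam hh
  have hvar := hu.variance_coeff hW' hα hα1 hT hlam hh N₀
  have hcov := hu.covariance_coeff hW' hα hα1 hT hlam hh N₀
  have hsqrt : √(Var[SFDE.coeff φ u N₀ T; P] / SFDE.covWeight α T (lam N₀) (lam N₀))
      = |inner ℝ g (φ N₀)| := by
    rw [hvar, mul_div_cancel_right₀ _ (hK N₀ N₀).ne', Real.sqrt_sq_eq_abs]
  refine ⟨hu.memLp_coeff hW' hα hα1 hT hlam hh, fun n => ⟨hM n, ?_⟩, hK N₀, ?_, hsqrt.symm,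
    ?_, ?_⟩
  · rw [hmean, mul_div_cancel_right₀ _ (hM n).ne']
  · rw [hvar]
    exact mul_pos (sq_pos_of_ne_zero hN₀) (hK N₀ N₀)
  -- The global sign `s` is the sign of `g_{N₀}`.
  · have hs : ∃ s : ℝ, (s = 1 ∨ s = -1) ∧
        inner ℝ g (φ N₀) = s * |inner ℝ g (φ N₀)| := by
      rcases abs_choice (inner ℝ g (φ N₀)) with h1 | h1
      · exact ⟨1, Or.inl rfl, by rw [h1, one_mul]⟩
      · exact ⟨-1, Or.inr rfl, by rw [h1]; ring⟩
    obtain ⟨s, hs1, hs2⟩ := hs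
    refine ⟨s, hs1, fun n => ?_⟩
    rw [hsqrt, hcov, eq_div_iff (mul_ne_zero (abs_ne_zero.2 hN₀) (hK N₀ n).ne')]
    linear_combination (-inner ℝ g (φ n) * SFDE.covWeight α T (lam N₀) (lam n)) * hs2
  · intro f' g' u' _ hu' hE hV hC
    have hmean' := hu'.integral_coeff hW' hα hα1 hT hlam hh
    have hcov' := hu'.covariance_coeff hW' hα hα1 hT hlam hh N₀
    have hf : f' = f := SFDE.hilbertBasis_ext φ fun n => by
      have h1 := hE n
      rw [hmean, hmean'] at h1
      exact mul_right_cancel₀ (hM n).ne' h1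
    have hprod : ∀ n, inner ℝ g' (φ N₀) * inner ℝ g' (φ n)
        = inner ℝ g (φ N₀) * inner ℝ g (φ n) := fun n => by
      have h1 := hC n
      rw [hcov, hcov'] at h1
      exact mul_right_cancel₀ (hK N₀ n).ne' h1
    have hg : g' = g ∨ g' = -g := by
      -- The case `n = N₀` of `hprod` gives `g'_{N₀} = ± g_{N₀}`; cancelling `g_{N₀}` in the other
      -- products carries the same sign to every `n`.
      rcases mul_self_eq_mul_self_iff.1 (hprod N₀) with h1 | h1
      · refine Or.inl (SFDE.hilbertBasis_ext φ fun n => ?_)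
        have h2 := hprod n
        rw [h1] at h2
        exact mul_left_cancel₀ hN₀ h2
      · refine Or.inr (SFDE.hilbertBasis_ext φ fun n => ?_)
        have h2 := hprod n
        rw [h1] at h2
        rw [inner_neg_left]
        exact mul_left_cancel₀ hN₀ (by linarith)
    refine ⟨hf, hg, ?_⟩
    rcases hg with rfl | rfl
    · rfl
    · exact abs_neg g
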